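/- All simplicial complexes are finite abstract simplicial complexes, with $\emptyset$ allowed as a face (of dimension $-1$); $V(\mathbf K)$ is the set of vertices of $\mathbf K$. A complex is pure if all its inclusion-wise maximal faces have the same dimension. $\operatorname{lk}(\sigma,\mathbf K)=\{\rho\setminus\sigma:\sigma\subseteq\rho\in\mathbf K\}$ is the link, $\operatorname{st}(\sigma,\mathbf K)=\{\rho\in\mathbf K:\rho\cup\sigma\in\mathbf K\}$ the closed star, $\mathbf X*\mathbf Y=\{\sigma\sqcup\tau:\sigma\in\mathbf X,\tau\in\mathbf Y\}$ the join, so that $V(\mathbf X*\mathbf Y)=V(\mathbf X)\sqcup V(\mathbf Y)$ when both complexes are nonempty, and $\operatorname{sd}\mathbf K$ is the barycentric subdivision, whose faces are the chains of nonempty faces of $\mathbf K$. For $S\subseteq V(\mathbf K)$ put $\operatorname{st}(S,\operatorname{sd}\mathbf K)=\bigcup_{v\in S}\operatorname{st}(\{\{v\}\},\operatorname{sd}\mathbf K)$. *Star decomposability in vertices* of a pair $(\operatorname{sd}\mathbf K,S)$, where $\mathbf K$ is pure of dimension $k\ge -1$ and $S\subseteq V(\mathbf K)$, is defined inductively. For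 $k=-1$ the pair $(\operatorname{sd}\{\emptyset\},\emptyset)=(\{\emptyset\},\emptyset)$ is star decomposable in vertices. For $k\ge 0$, a total order $\prec$ on $V(\mathbf K)$ *induces a star decomposition in vertices* of $(\operatorname{sd}\mathbf K,S)$ if - (order condition) $S=\{v\in V(\mathbf K): v\succeq w'\}$ for some $w'\in V(\mathbf K)$; - (link condition) for every $w\in V(\mathbf K)$ other than the last vertex, the pair $\bigl(\operatorname{sd}\operatorname{lk}(w,\mathbf K),\{v\in V(\operatorname{lk}(w,\mathbf K)):v\succ w\}\bigr)$ is star decomposable in vertices; - (last vertex condition) for the last vertex $\hat w$ the pair $\bigl(\operatorname{sd}\operatorname{lk}(\hat w,\mathbf K),V(\operatorname{lk}(\hat w,\mathbf K))\bigr)$ is star decomposable in vertices. The pair $(\operatorname{sd}\mathbf K,S)$ is star decomposable in vertices if some total order on $V(\mathbf K)$ induces such a decomposition (for the links in these conditions a new order may be chosen). "$\operatorname{sd}\mathbf K$" alone stands for the pair $(\operatorname{sd}\mathbf K,V(\mathbf K))$. **Proposition.** Let $\mathbf X$ and $\mathbf Y$ be pure simplicial complexes with $\dim\mathbf X,\dim\mathbf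 Y\ge 0$, and let $Y$ be a nonempty subset of $V(\mathbf Y)$. Assume that $\operatorname{sd}\mathbf X$ and $(\operatorname{sd}\mathbf Y,Y)$ are star decomposable in vertices and that all reduced homology groups (with integer coefficients) of $\operatorname{st}(Y,\operatorname{sd}\mathbf Y)$ are trivial. Let $\prec$ be any total order on $V(\mathbf X)\sqcup V(\mathbf Y)$ such that 1. the restriction of $\prec$ to $V(\mathbf X)$ induces a star decomposition in vertices of $\operatorname{sd}\mathbf X$; 2. the restriction of $\prec$ to $V(\mathbf Y)$ induces a star decomposition in vertices of $(\operatorname{sd}\mathbf Y,Y)$; 3. $Y=\{z\in V(\mathbf X)\sqcup V(\mathbf Y): z\succ\hat x\}$, where $\hat x$ is the last vertex of $V(\mathbf X)$ in $\prec$. Then $\prec$, as an order on $V(\mathbf X*\mathbf Y)=V(\mathbf X)\sqcup V(\mathbf Y)$, induces a star decomposition in vertices of the pair $(\operatorname{sd}(\mathbf X*\mathbf Y),Y)$; in particular this pair is star decomposable in vertices. -/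

import Mathlib

/-- A finite abstract simplicial complex with vertices in `V`: a finite family of finite sets,
closed under taking subsets. The empty set is allowed as a face, so that the complex with no face
at all and the complex whose only face is `∅` (of dimension `-1`) are different. -/
@[ext]
structure FinComplex (V : Type*) where
  faces : Finset (Finset V)
  down_closed : ∀ s ∈ faces, ∀ t, t ⊆ s → t ∈ faces

namespace FinComplex

variable {V W : Type*}

/-- The vertices, that is, the faces of size one. -/
def vertices (K : FinComplex V) : Set V := {v | {v} ∈ K.faces}

/-- The dimension: the maximum of `|s| - 1` over the faces `s`, and `⊥` (minus infinity) if there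
is no face. -/
def dim (K : FinComplex V) : WithBot ℤ :=
  K.faces.sup fun s => (((s.card : ℤ) - 1 : ℤ) : WithBot ℤ)

/-- A complex is pure if all its inclusion-wise maximal faces have the same dimension. -/
def IsPure (K : FinComplex V) : Prop :=
  ∀ s t : Finset V, Maximal (· ∈ K.faces) s → Maximal (· ∈ K.faces) t → s.card = t.card

/-- The link of `σ`: all `ρ \ σ` where `ρ` is a face containing `σ`. -/
def link [DecidableEq V] (K : FinComplex V) (σ : Finset V) : FinComplex V where
  faces := {ρ ∈ K.faces | σ ⊆ ρ}.image (· \ σ)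
  down_closed := by
    intro s hs t hts
    simp only [Finset.mem_image, Finset.mem_filter] at hs ⊢
    obtain ⟨ρ, ⟨hρ, hσ⟩, rfl⟩ := hs
    refine ⟨t ∪ σ, ⟨K.down_closed ρ hρ _ ?_, Finset.subset_union_right⟩, ?_⟩
    · exact Finset.union_subset (hts.trans Finset.sdiff_subset) hσ
    · have hd : Disjoint t σ := Finset.disjoint_of_subset_left hts Finset.sdiff_disjoint
      rw [Finset.union_sdiff_right, Finset.sdiff_eq_self_of_disjoint hd]

/-- The closed star of `σ`. -/
def star [DecidableEq V] (K : FinComplex V) (σ : Finset V) : FinComplex V where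
  faces := {ρ ∈ K.faces | ρ ∪ σ ∈ K.faces}
  down_closed := by
    intro s hs t hts
    simp only [Finset.mem_filter] at hs ⊢
    exact ⟨K.down_closed s hs.1 t hts,
      K.down_closed _ hs.2 _ (Finset.union_subset_union_left hts)⟩

open Classical in
/-- The star of a set `U` of vertices: the union of the closed stars of the elements of `U`. -/
noncomputable def starSet [DecidableEq V] (K : FinComplex V) (U : Set V) : FinComplex V where
  faces := {ρ ∈ K.faces | ∃ u ∈ U, ρ ∈ (K.star {u}).faces}
  down_closed := by
    intro s hs t hts
    simp only [Finset.mem_filter] at hs ⊢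
    obtain ⟨h, u, hu, hsu⟩ := hs
    exact ⟨K.down_closed s h t hts, u, hu, (K.star {u}).down_closed s hsu t hts⟩

/-- The join: all disjoint unions of a face of `K` and a face of `L`. -/
def join [DecidableEq V] [DecidableEq W] (K : FinComplex V) (L : FinComplex W) :
    FinComplex (V ⊕ W) where
  faces := (K.faces ×ˢ L.faces).image fun p => p.1.disjSum p.2
  down_closed := by
    intro s hs t hts
    simp only [Finset.mem_image, Finset.mem_product, Prod.exists] at hs ⊢
    obtain ⟨a, b, ⟨ha, hb⟩, rfl⟩ := hs
    refine ⟨t.toLeft, t.toRight, ⟨K.down_closed a ha _ ?_, L.down_closed b hb _ ?_⟩,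
      Finset.toLeft_disjSum_toRight⟩
    · intro v hv
      have h := hts (Finset.mem_toLeft.mp hv)
      simpa using h
    · intro v hv
      have h := hts (Finset.mem_toRight.mp hv)
      simpa using h

open Classical in
/-- The barycentric subdivision: its vertices are the nonempty faces of `K` and its faces are the
chains of nonempty faces of `K` with respect to inclusion. -/
noncomputable def sd (K : FinComplex V) : FinComplex (Finset V) where
  faces := {c ∈ K.faces.powerset |
    (∀ s ∈ c, s.Nonempty) ∧ IsChain (· ⊆ ·) (c : Set (Finset V))}
  down_closed := by
    intro s hs t hts
    simp only [Finset.mem_filter, Finset.mem_powerset] at hs ⊢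
    exact ⟨hts.trans hs.1, fun a ha => hs.2.1 a (hts ha),
      hs.2.2.mono (Finset.coe_subset.mpr hts)⟩

/-- `r` restricts to a strict total order on the set `S`. -/
def IsStrictTotalOn {A : Type*} (r : A → A → Prop) (S : Set A) : Prop :=
  IsStrictTotalOrder S (Subrel r (· ∈ S))

/-! ### Reduced simplicial homology with integer coefficients

The augmented chain complex of `K` is generated by the faces; the faces of size `m` have degree
`m - 1` (in particular `∅` has degree `-1`). Faces are oriented by a strict total order of the
vertices. -/

/-- The chains of degree `m - 1`: integer combinations of the faces of size `m`. -/
def chains (K : FinComplex V) (m : ℕ) : Submodule ℤ (Finset V →₀ ℤ) :=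
  Finsupp.supported ℤ ℤ {s | s ∈ K.faces ∧ s.card = m}

open Classical in
/-- The simplicial boundary map with respect to the order `lt`: the face
`{v_0 < v_1 < ... < v_n}` goes to the sum of the faces obtained by omitting `v_i`, with
sign `(-1) ^ i`. -/
noncomputable def boundary (lt : V → V → Prop) : (Finset V →₀ ℤ) →ₗ[ℤ] (Finset V →₀ ℤ) :=
  Finsupp.linearCombination ℤ fun s : Finset V =>
    ∑ v ∈ s, Finsupp.single (s.erase v) ((-1 : ℤ) ^ {u ∈ s | lt u v}.card)

/-- All reduced homology groups (with integer coefficients, in all degrees `≥ -1`) are trivial: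
every cycle is a boundary. The homology groups do not depend, up to isomorphism, on the order of
the vertices that is used to orient the faces. -/
def HasTrivialReducedHomology (K : FinComplex V) : Prop :=
  ∃ lt : V → V → Prop, IsStrictTotalOn lt K.vertices ∧
    ∀ m : ℕ, ∀ c ∈ K.chains m, boundary lt c = 0 → ∃ b ∈ K.chains (m + 1), boundary lt b = c

/-! ### Star decomposability in vertices -/

/-- `U` induces a star partition of `K`: the closed stars of the elements of `U` cover `K`, and no
two distinct elements of `U` are neighbours. -/
def InducesStarPartition [DecidableEq V] (K : FinComplex V) (U : Set V) : Prop :=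
  U ⊆ K.vertices ∧
    (∀ s, s ∈ K.faces ↔ ∃ u ∈ U, s ∈ (K.star {u}).faces) ∧
    ∀ u ∈ U, ∀ v ∈ U, u ≠ v → ({u, v} : Finset V) ∉ K.faces

/-- The part of the definition of a star decomposition in vertices of `(sd K, S)` that does not
refer to links: `K` is pure of dimension at least `0`, `r` is a total order on the vertices of `K`,
which induce a star partition of `sd K`, and `S` consists of all the vertices from some vertex `w`
on (order condition). -/
structure OrderCondition [DecidableEq V] (r : V → V → Prop) (K : FinComplex V) (S : Set V) :
    Prop where
  pure : K.IsPure
  dim_nonneg : 0 ≤ K.dim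
  total : IsStrictTotalOn r K.vertices
  starPartition : K.sd.InducesStarPartition ((fun v => {v}) '' K.vertices)
  order : ∃ w ∈ K.vertices, S = {v ∈ K.vertices | v = w ∨ r w v}

/-- `StarDecomposableInVertices K S`: the pair `(sd K, S)`, where `S` is a set of vertices of `K`,
is star decomposable in vertices. In dimension `-1` the pair `({∅}, ∅)` is. In
dimension `≥ 0` the pair is star decomposable in vertices if there is a total order on the vertices
of `K` satisfying the order condition, the link condition and the last vertex condition. -/
inductive StarDecomposableInVertices [DecidableEq V] : FinComplex V → Set V → Prop
  | base (K : FinComplex V) (hK : K.faces = {∅}) : StarDecomposableInVertices K ∅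
  | step (K : FinComplex V) (S : Set V) (r : V → V → Prop)
      (order : OrderCondition r K S)
      (link : ∀ w ∈ K.vertices, (∃ u ∈ K.vertices, r w u) →
        StarDecomposableInVertices (K.link {w}) {v ∈ (K.link {w}).vertices | r w v})
      (last : ∀ w ∈ K.vertices, (∀ u ∈ K.vertices, ¬ r w u) →
        StarDecomposableInVertices (K.link {w}) (K.link {w}).vertices) :
      StarDecomposableInVertices K S

/-- The order `r` on the vertices of `K` induces a star decomposition in vertices of the
pair `(sd K, S)`. -/
structure InducesStarDecompositionInVertices [DecidableEq V]
    (r : V → V → Prop) (K : FinComplex V) (S : Set V) : Prop where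
  order : OrderCondition r K S
  link : ∀ w ∈ K.vertices, (∃ u ∈ K.vertices, r w u) →
    StarDecomposableInVertices (K.link {w}) {v ∈ (K.link {w}).vertices | r w v}
  last : ∀ w ∈ K.vertices, (∀ u ∈ K.vertices, ¬ r w u) →
    StarDecomposableInVertices (K.link {w}) (K.link {w}).vertices

theorem starDecomposableInVertices_iff [DecidableEq V] (K : FinComplex V) (S : Set V) :
    StarDecomposableInVertices K S ↔
      (K.faces = {∅} ∧ S = ∅) ∨ ∃ r, InducesStarDecompositionInVertices r K S := by
  constructor
  · rintro (⟨_, hK⟩ | ⟨_, _, r, h1, h2, h3⟩)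
    · exact Or.inl ⟨hK, rfl⟩
    · exact Or.inr ⟨r, h1, h2, h3⟩
  · rintro (⟨hK, rfl⟩ | ⟨r, h1, h2, h3⟩)
    · exact .base K hK
    · exact .step K S r h1 h2 h3

end FinComplex

/-! The homology assumption is needed only through an Euler characteristic. Let `K.starSum S` be the
alternating number of chains of faces that meet `S`; for nonempty `S` it is minus the reduced Euler
characteristic of the star of `S` in `sd K`, so acyclicity makes it vanish.

Adding a vertex `y` to `S` changes this number by minus the star sum of `S` in the link of `y`
(`starSum_insert`). In a star decomposition with facets of size `d`, building `S` up from the last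
vertex therefore writes `(-1) ^ d * K.starSum S` as a sum of nonnegative contributions of links
(`starSum_of_isTerminal`). If the total is zero, each contribution is zero: vanishing passes to the
links of the vertices of `S` other than the last one (`starSum_link_eq_zero`).

The link of a vertex in a join is a link in one factor joined with the other factor. Its later
vertices either come from both factors or, from `xlast` on, from the second factor only. The first
case needs no Euler characteristic condition; the second needs exactly the vanishing that links
inherit. `joinDecomposable` proves both cases together by induction on the number of faces, and
`inducesStarDecompositionInVertices_join` is the common inductive step. -/

namespace FinComplex

/-! ### Reduced homology and the Euler–Poincaré formula -/

section Euler

variable {V : Type*}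

open Classical in
theorem boundary_single (lt : V → V → Prop) (s : Finset V) (a : ℤ) :
    boundary lt (Finsupp.single s a) =
      a • ∑ v ∈ s, Finsupp.single (s.erase v) ((-1 : ℤ) ^ {u ∈ s | lt u v}.card) := by
  simp only [boundary, Finsupp.linearCombination_single]

/-- Two vertices can be removed in either order. Removing the smaller one first lowers the position
of the larger by one, so the two terms cancel. -/
theorem boundary_boundary_single {lt : V → V → Prop} {s : Finset V}
    (irrefl : ∀ a ∈ s, ¬ lt a a) (trans : ∀ a ∈ s, ∀ b ∈ s, ∀ c ∈ s, lt a b → lt b c → lt a c)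
    (total : ∀ a ∈ s, ∀ b ∈ s, a ≠ b → lt a b ∨ lt b a) :
    boundary lt (boundary lt (Finsupp.single s 1)) = 0 := by
  classical
  have key : ∀ u ∈ s, ∀ v ∈ s, lt u v →
      ((-1 : ℤ) ^ {w ∈ s | lt w v}.card * (-1) ^ {w ∈ s.erase v | lt w u}.card) +
      ((-1 : ℤ) ^ {w ∈ s | lt w u}.card * (-1) ^ {w ∈ s.erase u | lt w v}.card) = 0 := by
    intro u hu v hv huv
    have hvu : ¬ lt v u := fun h => irrefl u hu (trans u hu v hv u hu huv h)
    have h1 : {w ∈ s.erase v | lt w u} = {w ∈ s | lt w u} := by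
      rw [Finset.filter_erase, Finset.erase_eq_of_notMem]
      simp [hvu]
    have h2 : {w ∈ s | lt w v}.card = {w ∈ s.erase u | lt w v}.card + 1 := by
      rw [Finset.filter_erase, Finset.card_erase_add_one]
      simp [hu, huv]
    rw [h1, h2]
    ring
  simp only [boundary_single, one_smul, map_sum, Finset.smul_sum]
  rw [Finset.sum_sigma']
  refine Finset.sum_involution (fun p _ => ⟨p.2, p.1⟩) ?_ ?_ ?_ ?_
  · rintro ⟨v, u⟩ h
    simp only [Finset.mem_sigma, Finset.mem_erase] at h
    obtain ⟨hv, huv, hu⟩ := h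
    simp only [Finsupp.smul_single, smul_eq_mul]
    rw [Finset.erase_right_comm, ← Finsupp.single_add]
    rcases total u hu v hv huv with h | h
    · rw [key u hu v hv h, Finsupp.single_zero]
    · rw [add_comm, key v hv u hu h, Finsupp.single_zero]
  · rintro ⟨v, u⟩ h - h'
    simp only [Finset.mem_sigma, Finset.mem_erase] at h
    simp only [Sigma.mk.injEq] at h'
    exact h.2.1 h'.1
  · rintro ⟨v, u⟩ h
    simp only [Finset.mem_sigma, Finset.mem_erase] at h ⊢
    exact ⟨h.2.2, h.2.1.symm, h.1⟩
  · rintro ⟨v, u⟩ h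
    rfl

theorem isStrictTotalOn_iff {A : Type*} {r : A → A → Prop} {S : Set A} :
    IsStrictTotalOn r S ↔ (∀ a ∈ S, ¬ r a a) ∧
      (∀ a ∈ S, ∀ b ∈ S, ∀ c ∈ S, r a b → r b c → r a c) ∧
      (∀ a ∈ S, ∀ b ∈ S, a ≠ b → r a b ∨ r b a) := by
  constructor
  · intro h
    have h : IsStrictTotalOrder S (Subrel r (· ∈ S)) := h
    refine ⟨fun a ha => h.irrefl ⟨a, ha⟩,
      fun a ha b hb c hc => h.trans ⟨a, ha⟩ ⟨b, hb⟩ ⟨c, hc⟩, fun a ha b hb hab => ?_⟩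
    by_contra! hn
    exact hab (congrArg Subtype.val (h.trichotomous ⟨a, ha⟩ ⟨b, hb⟩ hn.1 hn.2))
  · rintro ⟨h1, h2, h3⟩
    exact
      { irrefl := fun a => h1 a a.2
        trans := fun a b c => h2 a a.2 b b.2 c c.2
        trichotomous := fun a b hab hba => by
          by_contra hn
          rcases h3 a a.2 b b.2 (fun h => hn (Subtype.ext h)) with h | h
          exacts [hab h, hba h] }

theorem mem_vertices_of_mem {K : FinComplex V} {s : Finset V} (hs : s ∈ K.faces) {v : V}
    (hv : v ∈ s) : v ∈ K.vertices :=
  K.down_closed s hs _ (by simpa using hv)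

theorem single_mem_chains (K : FinComplex V) {s : Finset V} (hs : s ∈ K.faces) (a : ℤ) :
    Finsupp.single s a ∈ K.chains s.card :=
  Finsupp.single_mem_supported ℤ a ⟨hs, rfl⟩

theorem chains_induction (K : FinComplex V) {m : ℕ} (N : Submodule ℤ (Finset V →₀ ℤ))
    (h : ∀ s ∈ K.faces, s.card = m → Finsupp.single s 1 ∈ N) : K.chains m ≤ N := by
  rw [chains, Finsupp.supported_eq_span_single, Submodule.span_le]
  rintro _ ⟨s, ⟨hs, hm⟩, rfl⟩
  exact h s hs hm

theorem boundary_mem_chains (K : FinComplex V) (lt : V → V → Prop) {m : ℕ} {c : Finset V →₀ ℤ}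
    (hc : c ∈ K.chains (m + 1)) : boundary lt c ∈ K.chains m := by
  classical
  refine K.chains_induction ((K.chains m).comap (boundary lt)) (fun s hs hm => ?_) hc
  rw [Submodule.mem_comap, boundary_single, one_smul]
  refine Submodule.sum_mem _ fun v hv => ?_
  have h := K.single_mem_chains (K.down_closed s hs _ (s.erase_subset v))
    ((-1 : ℤ) ^ {u ∈ s | lt u v}.card)
  rwa [Finset.card_erase_of_mem hv, hm] at h

theorem boundary_boundary (K : FinComplex V) {lt : V → V → Prop}
    (hlt : IsStrictTotalOn lt K.vertices) {m : ℕ} {c : Finset V →₀ ℤ}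
    (hc : c ∈ K.chains m) : boundary lt (boundary lt c) = 0 := by
  obtain ⟨h1, h2, h3⟩ := isStrictTotalOn_iff.mp hlt
  refine K.chains_induction (LinearMap.ker (boundary lt ∘ₗ boundary lt)) (fun s hs _ => ?_) hc
  have hv : ∀ v ∈ s, v ∈ K.vertices := fun v => mem_vertices_of_mem hs
  exact boundary_boundary_single (fun a ha => h1 a (hv a ha))
    (fun a ha b hb c hc => h2 a (hv a ha) b (hv b hb) c (hv c hc))
    (fun a ha b hb => h3 a (hv a ha) b (hv b hb))

instance (K : FinComplex V) (m : ℕ) : Module.Finite ℤ (K.chains m) := by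
  have : Finite {s | s ∈ K.faces ∧ s.card = m} := K.faces.finite_toSet.subset fun s hs => hs.1
  exact Module.Finite.equiv (Finsupp.supportedEquivFinsupp (M := ℤ) (R := ℤ)
    {s | s ∈ K.faces ∧ s.card = m}).symm

theorem finrank_chains (K : FinComplex V) (m : ℕ) :
    Module.finrank ℤ (K.chains m) = {s ∈ K.faces | s.card = m}.card := by
  have e := Finsupp.supportedEquivFinsupp (M := ℤ) (R := ℤ) {s | s ∈ K.faces ∧ s.card = m}
  have : Fintype {s | s ∈ K.faces ∧ s.card = m} :=
    (K.faces.finite_toSet.subset fun s hs => hs.1).fintype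
  rw [chains, e.finrank_eq, Module.finrank_finsupp_self, ← Set.toFinset_card]
  congr 1
  ext s
  simp

/-- Euler–Poincaré for acyclic complexes. -/
theorem HasTrivialReducedHomology.sum_eq_zero {K : FinComplex V}
    (hK : K.HasTrivialReducedHomology) : ∑ s ∈ K.faces, (-1 : ℤ) ^ s.card = 0 := by
  obtain ⟨lt, hlt, hK⟩ := hK
  let g (m : ℕ) : K.chains m →ₗ[ℤ] (Finset V →₀ ℤ) := (boundary lt).domRestrict (K.chains m)
  let b (m : ℕ) : ℕ := Module.finrank ℤ (LinearMap.range (g m))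
  -- Exactness: acyclicity gives one inclusion, `∂∂ = 0` the other.
  have hker : ∀ m, (LinearMap.ker (g m)).map (K.chains m).subtype = LinearMap.range (g (m + 1)) := by
    intro m
    ext c
    simp only [Submodule.mem_map, LinearMap.mem_ker, LinearMap.mem_range]
    constructor
    · rintro ⟨⟨c, hc⟩, h, rfl⟩
      obtain ⟨a, ha, rfl⟩ := hK m c hc h
      exact ⟨⟨a, ha⟩, rfl⟩
    · rintro ⟨⟨a, ha⟩, rfl⟩
      exact ⟨⟨_, K.boundary_mem_chains lt ha⟩, K.boundary_boundary hlt ha, rfl⟩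
  -- Rank–nullity, with the kernel replaced by the next image; the alternating sum of these
  -- equations telescopes.
  have hrank : ∀ m, {s ∈ K.faces | s.card = m}.card = b m + b (m + 1) := by
    intro m
    rw [← finrank_chains, ← Submodule.finrank_quotient_add_finrank (LinearMap.ker (g m)),
      (g m).quotKerEquivRange.finrank_eq, 
      (Submodule.equivSubtypeMap (K.chains m) (LinearMap.ker (g m))).finrank_eq, hker]
  have hb0 : b 0 = 0 := by
    have : g 0 = 0 := by
      ext ⟨c, hc⟩ : 1
      refine K.chains_induction (LinearMap.ker (boundary lt)) (fun s hs h => ?_) hc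
      rw [Finset.card_eq_zero] at h
      simp [h, boundary_single]
    simp [b, this]
  obtain ⟨N, hN⟩ : ∃ N, ∀ s ∈ K.faces, s.card < N :=
    ⟨K.faces.sup Finset.card + 1, fun s hs => Nat.lt_succ_of_le (Finset.le_sup hs)⟩
  have hbN : b N = 0 := by
    have h := hrank N
    rw [Finset.card_eq_zero.mpr (Finset.filter_eq_empty_iff.mpr fun s hs => (hN s hs).ne)] at h
    omega
  have hsum : ∀ n, ∑ m ∈ Finset.range n, (-1 : ℤ) ^ m * ({s ∈ K.faces | s.card = m}.card : ℤ) =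
      - (-1) ^ n * (b n : ℤ) := by
    intro n
    induction n with
    | zero => simp [hb0]
    | succ n ih => rw [Finset.sum_range_succ, ih, hrank]; push_cast; ring
  rw [← Finset.sum_fiberwise_of_maps_to (t := Finset.range N) (g := Finset.card)
    (fun s hs => Finset.mem_range.mpr (hN s hs))]
  have := hsum N
  rw [hbN] at this
  simp only [Nat.cast_zero, mul_zero] at this
  rw [← this]
  refine Finset.sum_congr rfl fun m _ => ?_
  rw [Finset.sum_congr rfl (g := fun _ => (-1 : ℤ) ^ m)]
  · simp [mul_comm]
  · intro s hs
    rw [(Finset.mem_filter.mp hs).2]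

end Euler

end FinComplex

/-! ### Alternating chain counts in finite posets -/

section ChainSum

variable {α β : Type*} [PartialOrder α] [PartialOrder β]

open Classical in
/-- The chains of elements of `Q`. -/
noncomputable def chainsIn (Q : Finset α) : Finset (Finset α) :=
  {c ∈ Q.powerset | IsChain (· ≤ ·) (c : Set α)}

theorem mem_chainsIn {Q c : Finset α} :
    c ∈ chainsIn Q ↔ c ⊆ Q ∧ IsChain (· ≤ ·) (c : Set α) := by
  classical
  simp [chainsIn]

/-- The alternating number of chains of elements of `Q`: the negative of the reduced Euler
characteristic of the order complex of `Q`. -/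
noncomputable def chainSum (Q : Finset α) : ℤ := ∑ c ∈ chainsIn Q, (-1) ^ c.card

theorem chainSum_empty : chainSum (∅ : Finset α) = 1 := by
  have : chainsIn (∅ : Finset α) = {∅} := by
    ext c
    simp only [mem_chainsIn, Finset.subset_empty, Finset.mem_singleton, and_iff_left_iff_imp]
    rintro rfl
    simp
  simp [chainSum, this]

/-- The order complex is a cone with apex `m`: inserting or deleting `m` is a sign-reversing
involution on chains. -/
theorem chainSum_eq_zero_of_least {Q : Finset α} {m : α} (hm : m ∈ Q) (hle : ∀ s ∈ Q, m ≤ s) :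
    chainSum Q = 0 := by
  classical
  have hins : ∀ c ∈ chainsIn Q, insert m c ∈ chainsIn Q := by
    intro c hc
    rw [mem_chainsIn] at hc ⊢
    refine ⟨Finset.insert_subset hm hc.1, ?_⟩
    rw [Finset.coe_insert]
    exact hc.2.insert fun b hb _ => Or.inl (hle b (hc.1 hb))
  have hera : ∀ c ∈ chainsIn Q, c.erase m ∈ chainsIn Q := by
    intro c hc
    rw [mem_chainsIn] at hc ⊢
    exact ⟨(c.erase_subset m).trans hc.1, hc.2.mono (Finset.coe_subset.mpr (c.erase_subset m))⟩
  refine Finset.sum_involution (fun c _ => if m ∈ c then c.erase m else insert m c) ?_ ?_ ?_ ?_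
  · intro c hc
    split_ifs with h
    · rw [← Finset.card_erase_add_one h]; ring
    · rw [Finset.card_insert_of_notMem h]; ring
  · intro c hc _
    split_ifs with h
    · exact fun h' => Finset.notMem_erase m c (h'.symm ▸ h)
    · exact fun h' => h (h' ▸ Finset.mem_insert_self m c)
  · intro c hc
    split_ifs with h
    exacts [hera c hc, hins c hc]
  · intro c hc
    by_cases h : m ∈ c <;> simp [h]

/-- No element of `P \ Q` is comparable to one of `Q \ P`, so each chain of the union lies in `P` or
in `Q`, and inclusion–exclusion applies. -/
theorem chainSum_union [DecidableEq α] {P Q : Finset α}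
    (h : ∀ a ∈ P, ∀ b ∈ Q, a ≤ b ∨ b ≤ a → a ∈ Q ∨ b ∈ P) :
    chainSum (P ∪ Q) + chainSum (P ∩ Q) = chainSum P + chainSum Q := by
  classical
  have hu : chainsIn (P ∪ Q) = chainsIn P ∪ chainsIn Q := by
    ext c
    simp only [Finset.mem_union, mem_chainsIn, ← or_and_right]
    refine and_congr_left fun hc => ⟨fun hcu => ?_, ?_⟩
    · by_contra! hn
      obtain ⟨a, hac, haP⟩ := Finset.not_subset.mp hn.1
      obtain ⟨b, hbc, hbQ⟩ := Finset.not_subset.mp hn.2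
      have haQ := (Finset.mem_union.mp (hcu hac)).resolve_left haP
      have hbP := (Finset.mem_union.mp (hcu hbc)).resolve_right hbQ
      rcases h b hbP a haQ (hc.total hbc hac) with h | h
      exacts [hbQ h, haP h]
    · rintro (h | h)
      exacts [h.trans Finset.subset_union_left, h.trans Finset.subset_union_right]
  have hi : chainsIn (P ∩ Q) = chainsIn P ∩ chainsIn Q := by
    ext c
    simp only [Finset.mem_inter, mem_chainsIn, Finset.subset_inter_iff]
    tauto
  rw [chainSum, chainSum, hu, hi, Finset.sum_union_inter, chainSum, chainSum]

theorem chainSum_image [DecidableEq β] {Q : Finset α} {φ : α → β}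
    (h : ∀ a ∈ Q, ∀ b ∈ Q, φ a ≤ φ b ↔ a ≤ b) : chainSum (Q.image φ) = chainSum Q := by
  classical
  have hinj : Set.InjOn φ Q := fun a ha b hb hab =>
    le_antisymm ((h a ha b hb).mp hab.le) ((h b hb a ha).mp hab.ge)
  have him : chainsIn (Q.image φ) = (chainsIn Q).image (Finset.image φ) := by
    ext c
    simp only [Finset.mem_image, mem_chainsIn]
    constructor
    · rintro ⟨hc, hch⟩
      obtain ⟨d, hd, rfl⟩ := Finset.subset_image_iff.mp hc
      refine ⟨d, ⟨hd, fun a ha b hb hab => ?_⟩, rfl⟩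
      have := hch.total (Finset.mem_image_of_mem φ ha) (Finset.mem_image_of_mem φ hb)
      rwa [h a (hd ha) b (hd hb), h b (hd hb) a (hd ha)] at this
    · rintro ⟨d, ⟨hd, hch⟩, rfl⟩
      refine ⟨Finset.image_subset_image hd, ?_⟩
      rw [Finset.coe_image]
      rintro _ ⟨a, ha, rfl⟩ _ ⟨b, hb, rfl⟩ _
      simpa only [h a (hd ha) b (hd hb), h b (hd hb) a (hd ha)] using hch.total ha hb
  rw [chainSum, him, Finset.sum_image, chainSum]
  · refine Finset.sum_congr rfl fun c hc => ?_
    rw [Finset.card_image_of_injOn (hinj.mono (Finset.coe_subset.mpr (mem_chainsIn.mp hc).1))]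
  · intro c hc d hd hcd
    have hc := (mem_chainsIn.mp hc).1
    have hd := (mem_chainsIn.mp hd).1
    have hcd : c.image φ = d.image φ := hcd
    apply Finset.coe_injective
    refine (hinj.image_eq_image_iff (by exact_mod_cast hc) (by exact_mod_cast hd)).mp ?_
    rw [← Finset.coe_image, ← Finset.coe_image, hcd]

end ChainSum

/-! ### Star sums and their recurrence -/

namespace FinComplex

variable {V : Type*}

open Classical in
/-- The alternating number of chains of faces of `K` that meet `S`. -/
noncomputable def starSum (K : FinComplex V) (S : Set V) : ℤ :=
  chainSum {s ∈ K.faces | ∃ v ∈ s, v ∈ S}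

theorem starSum_empty (K : FinComplex V) : K.starSum ∅ = 1 := by
  simp [starSum, chainSum_empty]

theorem starSum_congr (K : FinComplex V) {S T : Set V} (h : ∀ v ∈ K.vertices, v ∈ S ↔ v ∈ T) :
    K.starSum S = K.starSum T := by
  classical
  unfold starSum
  congr 1
  refine Finset.filter_congr fun s hs => exists_congr fun v => and_congr_right fun hv => ?_
  exact h v (mem_vertices_of_mem hs hv)

theorem mem_sd {K : FinComplex V} {c : Finset (Finset V)} : c ∈ K.sd.faces ↔
    c ⊆ K.faces ∧ (∀ s ∈ c, s.Nonempty) ∧ IsChain (· ⊆ ·) (c : Set (Finset V)) := by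
  simp [sd]

/-- A vertex of the smallest member of a chain lies in all members. -/
theorem exists_mem_all_of_isChain {c : Finset (Finset V)} (hc : c.Nonempty)
    (hchain : IsChain (· ⊆ ·) (c : Set (Finset V))) {S : Set V} (hS : ∀ s ∈ c, ∃ v ∈ s, v ∈ S) :
    ∃ v ∈ S, ∀ s ∈ c, v ∈ s := by
  obtain ⟨m, hm, hmin⟩ := c.exists_min_image Finset.card hc
  obtain ⟨v, hv, hvS⟩ := hS m hm
  refine ⟨v, hvS, fun s hs => ?_⟩
  rcases hchain.total hm hs with h | h
  · exact h hv
  · rwa [Finset.eq_of_subset_of_card_le h (hmin s hs)]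

variable [DecidableEq V]

theorem mem_link_singleton {K : FinComplex V} {w : V} {s : Finset V} :
    s ∈ (K.link {w}).faces ↔ w ∉ s ∧ insert w s ∈ K.faces := by
  simp only [link, Finset.mem_image, Finset.mem_filter, Finset.singleton_subset_iff]
  constructor
  · rintro ⟨t, ⟨ht, hw⟩, rfl⟩
    refine ⟨by simp, ?_⟩
    rwa [Finset.sdiff_singleton_eq_erase, Finset.insert_erase hw]
  · rintro ⟨hw, hs⟩
    refine ⟨_, ⟨hs, Finset.mem_insert_self w s⟩, ?_⟩
    rw [Finset.sdiff_singleton_eq_erase, Finset.erase_insert hw]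

/-- Inclusion–exclusion for the faces meeting `S` and the faces containing `y`. The latter have
least element `{y}` and contribute zero; the intersection is a copy of the faces of the link meeting
`S`, via `insert y`. -/
theorem starSum_insert (K : FinComplex V) {y : V} (hy : y ∈ K.vertices) {S : Set V} (hyS : y ∉ S) :
    K.starSum (insert y S) = K.starSum S - (K.link {y}).starSum S := by
  classical
  set P : Finset (Finset V) := {s ∈ K.faces | ∃ v ∈ s, v ∈ S} with hP
  set Q : Finset (Finset V) := {s ∈ K.faces | y ∈ s} with hQ
  have hmP : ∀ s, s ∈ P ↔ s ∈ K.faces ∧ ∃ v ∈ s, v ∈ S := fun s => by simp [hP]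
  have hmQ : ∀ s, s ∈ Q ↔ s ∈ K.faces ∧ y ∈ s := fun s => by simp [hQ]
  have hPQ : K.starSum (insert y S) = chainSum (P ∪ Q) := by
    unfold starSum
    congr 1
    ext s
    simp only [Finset.mem_filter, Finset.mem_union, hmP, hmQ, Set.mem_insert_iff, ← and_or_left]
    refine and_congr_right fun _ => ⟨?_, ?_⟩
    · rintro ⟨v, hv, rfl | h⟩
      exacts [Or.inr hv, Or.inl ⟨v, hv, h⟩]
    · rintro (⟨v, hv, h⟩ | h)
      exacts [⟨v, hv, Or.inr h⟩, ⟨y, h, Or.inl rfl⟩]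
  have hQ0 : chainSum Q = 0 :=
    chainSum_eq_zero_of_least (m := {y}) ((hmQ _).mpr ⟨hy, Finset.mem_singleton_self y⟩)
      fun s hs => Finset.singleton_subset_iff.mpr ((hmQ s).mp hs).2
  have hlink : chainSum (P ∩ Q) = (K.link {y}).starSum S := by
    unfold starSum
    symm
    rw [← chainSum_image (φ := insert y)]
    · congr 1
      ext s
      symm
      simp only [Finset.mem_inter, hmP, hmQ, Finset.mem_image, Finset.mem_filter,
        mem_link_singleton]
      constructor
      · rintro ⟨⟨hs, v, hv, hvS⟩, -, hys⟩
        refine ⟨s.erase y, ⟨⟨by simp, by rwa [Finset.insert_erase hys]⟩, v, ?_, hvS⟩,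
          Finset.insert_erase hys⟩
        exact Finset.mem_erase.mpr ⟨fun h => hyS (h ▸ hvS), hv⟩
      · rintro ⟨t, ⟨⟨_, ht⟩, v, hv, hvS⟩, rfl⟩
        exact ⟨⟨ht, v, Finset.mem_insert_of_mem hv, hvS⟩, ht, Finset.mem_insert_self _ _⟩
    · intro a ha b hb
      simp only [Finset.mem_filter, mem_link_singleton] at ha hb
      exact Finset.insert_subset_insert_iff ha.1.1
  have := chainSum_union (P := P) (Q := Q) (by
    rintro a ha b hb (hab | hba)
    · obtain ⟨_, v, hv, hvS⟩ := (hmP a).mp ha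
      exact Or.inr ((hmP b).mpr ⟨((hmQ b).mp hb).1, v, hab hv, hvS⟩)
    · exact Or.inl ((hmQ a).mpr ⟨((hmP a).mp ha).1, hba ((hmQ b).mp hb).2⟩))
  rw [hPQ, ← hlink, starSum]
  linarith

theorem mem_star_sd {K : FinComplex V} {c : Finset (Finset V)} {v : V} (hv : v ∈ K.vertices) :
    c ∈ (K.sd.star {{v}}).faces ↔ c ∈ K.sd.faces ∧ ∀ s ∈ c, v ∈ s := by
  simp only [star, Finset.mem_filter]
  refine and_congr_right fun hc => ⟨fun h s hs => ?_, fun h => ?_⟩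
  · have ht := (mem_sd.mp h).2.2.total (x := {v}) (y := s) (by simp) (by simp [hs])
    rcases ht with h' | h'
    · exact Finset.singleton_subset_iff.mp h'
    · obtain ⟨u, hu⟩ := (mem_sd.mp hc).2.1 s hs
      rwa [← Finset.mem_singleton.mp (h' hu)]
  · rw [mem_sd] at hc ⊢
    refine ⟨Finset.union_subset hc.1 (Finset.singleton_subset_iff.mpr hv), fun s hs => ?_, ?_⟩
    · rcases Finset.mem_union.mp hs with hs | hs
      · exact hc.2.1 s hs
      · rw [Finset.mem_singleton.mp hs]; exact Finset.singleton_nonempty v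
    · rw [Finset.union_comm, ← Finset.insert_eq, Finset.coe_insert]
      exact hc.2.2.insert fun s hs _ => Or.inl (Finset.singleton_subset_iff.mpr (h s hs))

/-- The faces of the star of `S` are precisely the chains counted by `starSum`, so Euler–Poincaré
applies. -/
theorem starSum_eq_zero_of_hasTrivialReducedHomology {K : FinComplex V} {S : Set V}
    (hS : S ⊆ K.vertices) (hne : S.Nonempty)
    (h : (K.sd.starSet ((fun y => {y}) '' S)).HasTrivialReducedHomology) : K.starSum S = 0 := by
  classical
  rw [← h.sum_eq_zero, starSum, chainSum]
  congr 1
  ext c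
  have hstar : c ∈ (K.sd.starSet ((fun y => {y}) '' S)).faces ↔
      c ∈ K.sd.faces ∧ ∃ v ∈ S, ∀ s ∈ c, v ∈ s := by
    simp only [starSet, Finset.mem_filter, Set.exists_mem_image]
    constructor
    · rintro ⟨hc, v, hv, hcv⟩
      exact ⟨hc, v, hv, ((mem_star_sd (hS hv)).mp hcv).2⟩
    · rintro ⟨hc, v, hv, hcv⟩
      exact ⟨hc, v, hv, (mem_star_sd (hS hv)).mpr ⟨hc, hcv⟩⟩
  rw [hstar, mem_chainsIn, mem_sd]
  constructor
  · rintro ⟨hc, hchain⟩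
    have hm : ∀ s ∈ c, ∃ v ∈ s, v ∈ S := fun s hs => (Finset.mem_filter.mp (hc hs)).2
    refine ⟨⟨fun s hs => (Finset.mem_filter.mp (hc hs)).1,
      fun s hs => (hm s hs).imp fun _ => And.left, hchain⟩, ?_⟩
    -- The empty chain is in the star because `S` is nonempty.
    rcases c.eq_empty_or_nonempty with rfl | hne'
    · exact hne.imp fun v hv => ⟨hv, by simp⟩
    · exact exists_mem_all_of_isChain hne' hchain hm
  · rintro ⟨⟨hc, -, hchain⟩, v, hv, hcv⟩
    exact ⟨fun s hs => Finset.mem_filter.mpr ⟨hc hs, v, hcv s hs, hv⟩, hchain⟩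

/-! ### Extremal elements of finite total orders -/

section StrictTotalOrder

variable {A : Type*} {r : A → A → Prop} {S : Set A}

theorem IsStrictTotalOn.mono (h : IsStrictTotalOn r S) {T : Set A} (hTS : T ⊆ S) :
    IsStrictTotalOn r T := by
  obtain ⟨h1, h2, h3⟩ := isStrictTotalOn_iff.mp h
  exact isStrictTotalOn_iff.mpr ⟨fun a ha => h1 a (hTS ha),
    fun a ha b hb c hc => h2 a (hTS ha) b (hTS hb) c (hTS hc),
    fun a ha b hb => h3 a (hTS ha) b (hTS hb)⟩

theorem IsStrictTotalOn.swap (h : IsStrictTotalOn r S) : IsStrictTotalOn (fun a b => r b a) S := by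
  obtain ⟨h1, h2, h3⟩ := isStrictTotalOn_iff.mp h
  exact isStrictTotalOn_iff.mpr ⟨h1, fun a ha b hb c hc hab hbc => h2 c hc b hb a ha hbc hab,
    fun a ha b hb hab => (h3 a ha b hb hab).symm⟩

theorem IsStrictTotalOn.exists_least (h : IsStrictTotalOn r S) (hfin : S.Finite)
    (hne : S.Nonempty) : ∃ w ∈ S, ∀ v ∈ S, v ≠ w → r w v := by
  induction S, hfin using Set.Finite.induction_on with
  | empty => simp at hne
  | @insert a S _ _ ih =>
    rcases S.eq_empty_or_nonempty with rfl | hS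
    · exact ⟨a, by simp, by simp⟩
    obtain ⟨w, hw, hmin⟩ := ih (h.mono (Set.subset_insert a S)) hS
    obtain ⟨h1, h2, h3⟩ := isStrictTotalOn_iff.mp h
    have hw' := Set.mem_insert_of_mem a hw
    have ha := Set.mem_insert a S
    by_cases haw : r a w
    · refine ⟨a, ha, ?_⟩
      rintro v (rfl | hv) hva
      · exact absurd rfl hva
      · by_cases hvw : v = w
        · rwa [hvw]
        · exact h2 a ha w hw' v (Or.inr hv) haw (hmin v hv hvw)
    · refine ⟨w, hw', ?_⟩
      rintro v (rfl | hv) hvw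
      · exact (h3 v ha w hw' hvw).resolve_left haw
      · exact hmin v hv hvw

theorem IsStrictTotalOn.exists_greatest (h : IsStrictTotalOn r S) (hfin : S.Finite)
    (hne : S.Nonempty) : ∃ w ∈ S, ∀ v ∈ S, v ≠ w → r v w :=
  h.swap.exists_least hfin hne

end StrictTotalOrder

/-! ### Terminal sets, links and star partitions -/

section Basic

variable {V : Type*}

theorem vertices_finite (K : FinComplex V) : K.vertices.Finite :=
  K.faces.finite_toSet.preimage (f := fun v => ({v} : Finset V))
    Finset.singleton_injective.injOn

theorem zero_le_dim_iff {K : FinComplex V} : 0 ≤ K.dim ↔ K.vertices.Nonempty := by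
  rw [dim, Finset.le_sup_iff (WithBot.bot_lt_coe _)]
  constructor
  · rintro ⟨s, hs, h⟩
    have h : (0 : ℤ) ≤ (s.card : ℤ) - 1 := WithBot.coe_le_coe.mp h
    obtain ⟨v, hv⟩ := Finset.card_pos.mp (by omega : 0 < s.card)
    exact ⟨v, mem_vertices_of_mem hs hv⟩
  · rintro ⟨v, hv⟩
    exact ⟨{v}, hv, by simp⟩

theorem empty_mem_of_mem {K : FinComplex V} {s : Finset V} (hs : s ∈ K.faces) : ∅ ∈ K.faces :=
  K.down_closed s hs _ (Finset.empty_subset s)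

theorem vertices_eq_empty {K : FinComplex V} (hK : K.faces = {∅}) : K.vertices = ∅ := by
  ext v
  simp [vertices, hK]

/-- The set `S` of vertices of `K` is nonempty and closed upwards for `r`. -/
structure IsTerminal (r : V → V → Prop) (K : FinComplex V) (S : Set V) : Prop where
  subset : S ⊆ K.vertices
  nonempty : S.Nonempty
  upper : ∀ v ∈ S, ∀ u ∈ K.vertices, r v u → u ∈ S

variable [DecidableEq V]

theorem mem_vertices_link {K : FinComplex V} {w v : V} :
    v ∈ (K.link {w}).vertices ↔ v ≠ w ∧ {w, v} ∈ K.faces := by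
  change {v} ∈ (K.link {w}).faces ↔ _
  rw [mem_link_singleton, Finset.mem_singleton, ne_comm]

theorem vertices_link_subset (K : FinComplex V) (w : V) :
    (K.link {w}).vertices ⊆ K.vertices := fun v hv =>
  mem_vertices_of_mem (mem_vertices_link.mp hv).2 (by simp)

theorem card_link_lt {K : FinComplex V} {w : V} (hw : w ∈ K.vertices) :
    (K.link {w}).faces.card < K.faces.card := by
  refine Finset.card_lt_card ⟨fun s hs => ?_, fun h => ?_⟩
  · exact K.down_closed _ (mem_link_singleton.mp hs).2 _ (Finset.subset_insert w s)
  · exact (mem_link_singleton.mp (h hw)).1 (Finset.mem_singleton_self w)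

theorem maximal_insert_of_maximal_link {K : FinComplex V} {w : V} {t : Finset V}
    (ht : Maximal (· ∈ (K.link {w}).faces) t) : Maximal (· ∈ K.faces) (insert w t) := by
  obtain ⟨hwt, hins⟩ := mem_link_singleton.mp ht.prop
  refine ⟨hins, fun s hs hts => ?_⟩
  have hws : w ∈ s := hts (Finset.mem_insert_self w t)
  have := ht.le_of_ge (y := s.erase w)
    (mem_link_singleton.mpr ⟨Finset.notMem_erase w s, by rwa [Finset.insert_erase hws]⟩)
    (Finset.subset_erase.mpr ⟨(Finset.subset_insert w t).trans hts, hwt⟩)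
  rw [← Finset.insert_erase hws]
  exact Finset.insert_subset_insert w this

/-- Every chain of nonempty faces has a common vertex, and distinct singletons are incomparable.
Hence this clause of `OrderCondition` is automatic. -/
theorem inducesStarPartition_sd {K : FinComplex V} (hK : K.vertices.Nonempty) :
    K.sd.InducesStarPartition ((fun v => {v}) '' K.vertices) := by
  refine ⟨?_, fun c => ?_, ?_⟩
  · rintro _ ⟨v, hv, rfl⟩
    change {{v}} ∈ K.sd.faces
    rw [mem_sd]
    exact ⟨Finset.singleton_subset_iff.mpr hv, by simp, by simp⟩
  · simp only [Set.exists_mem_image]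
    constructor
    · intro hc
      obtain ⟨h1, h2, h3⟩ := mem_sd.mp hc
      obtain ⟨v, hv, hvc⟩ : ∃ v ∈ K.vertices, ∀ s ∈ c, v ∈ s := by
        rcases c.eq_empty_or_nonempty with rfl | hne
        · exact hK.imp fun v hv => ⟨hv, by simp⟩
        · exact exists_mem_all_of_isChain hne h3 fun s hs =>
            (h2 s hs).imp fun v hv => ⟨hv, mem_vertices_of_mem (h1 hs) hv⟩
      exact ⟨v, hv, (mem_star_sd hv).mpr ⟨hc, hvc⟩⟩
    · rintro ⟨v, hv, hc⟩
      exact ((mem_star_sd hv).mp hc).1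
  · rintro _ ⟨u, hu, rfl⟩ _ ⟨v, hv, rfl⟩ huv h
    have := (mem_sd.mp h).2.2 (by simp) (by simp) huv
    simp only [Finset.singleton_subset_singleton] at this
    rcases this with rfl | rfl <;> exact huv rfl

end Basic

/-! ### Signs of star sums and inheritance of vanishing -/

section Conditions

variable {V : Type*} [DecidableEq V] {r : V → V → Prop} {K : FinComplex V} {S T : Set V}

theorem OrderCondition.vertices_nonempty (h : OrderCondition r K S) : K.vertices.Nonempty :=
  zero_le_dim_iff.mp h.dim_nonneg

theorem OrderCondition.isTerminal (h : OrderCondition r K S) : IsTerminal r K S := by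
  obtain ⟨_, h2, _⟩ := isStrictTotalOn_iff.mp h.total
  obtain ⟨w, hw, rfl⟩ := h.order
  refine ⟨fun v hv => hv.1, ⟨w, hw, Or.inl rfl⟩, ?_⟩
  rintro v ⟨hv, rfl | hwv⟩ u hu hvu
  exacts [⟨hu, Or.inr hvu⟩, ⟨hu, Or.inr (h2 w hw v hv u hu hwv hvu)⟩]

theorem IsTerminal.orderCondition (h : IsTerminal r K S) (hpure : K.IsPure)
    (htotal : IsStrictTotalOn r K.vertices) : OrderCondition r K S := by
  have hne : K.vertices.Nonempty := h.nonempty.mono h.subset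
  refine ⟨hpure, zero_le_dim_iff.mpr hne, htotal, inducesStarPartition_sd hne, ?_⟩
  obtain ⟨w, hw, hmin⟩ := (htotal.mono h.subset).exists_least
    (K.vertices_finite.subset h.subset) h.nonempty
  refine ⟨w, h.subset hw, Set.ext fun v => ⟨fun hv => ⟨h.subset hv, ?_⟩, ?_⟩⟩
  · by_cases hvw : v = w
    exacts [Or.inl hvw, Or.inr (hmin v hv hvw)]
  · rintro ⟨hv, rfl | hwv⟩
    exacts [hw, h.upper w hw v hv hwv]

/-- The link and last vertex conditions do not involve the distinguished set, so one order serves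
all terminal sets. -/
theorem InducesStarDecompositionInVertices.of_isTerminal
    (h : InducesStarDecompositionInVertices r K T) (hS : IsTerminal r K S) :
    InducesStarDecompositionInVertices r K S :=
  ⟨hS.orderCondition h.order.pure h.order.total, h.link, h.last⟩

theorem InducesStarDecompositionInVertices.starDecomposable
    (h : InducesStarDecompositionInVertices r K S) : StarDecomposableInVertices K S :=
  .step K S r h.order h.link h.last

theorem InducesStarDecompositionInVertices.isTerminal_vertices
    (h : InducesStarDecompositionInVertices r K T) : IsTerminal r K K.vertices :=
  ⟨subset_rfl, h.order.vertices_nonempty, fun _ _ _ hu _ => hu⟩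

theorem StarDecomposableInVertices.empty_mem (h : StarDecomposableInVertices K S) :
    ∅ ∈ K.faces := by
  rcases h with ⟨_, hK⟩ | ⟨_, _, r, h, _, _⟩
  · simp [hK]
  · obtain ⟨v, hv⟩ := h.vertices_nonempty
    exact empty_mem_of_mem hv

/-- Induction on the size of `S`, removing its least vertex `y`. The facets of the link of `y` have
size `d - 1`, so the minus sign in `starSum_insert` is absorbed and both terms are nonnegative; a
zero total forces both to vanish. -/
theorem InducesStarDecompositionInVertices.starSum_of_isTerminal
    (h : InducesStarDecompositionInVertices r K T) {d : ℕ}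
    (hd : ∀ s, Maximal (· ∈ K.faces) s → s.card = d)
    (ih : ∀ w ∈ K.vertices, (∃ u ∈ K.vertices, r w u) → ∀ e : ℕ,
      (∀ t, Maximal (· ∈ (K.link {w}).faces) t → t.card = e) →
      0 ≤ (-1) ^ e * (K.link {w}).starSum {v ∈ (K.link {w}).vertices | r w v})
    (hS : IsTerminal r K S) :
    0 ≤ (-1) ^ d * K.starSum S ∧ (K.starSum S = 0 → ∀ y ∈ S, (∃ u ∈ K.vertices, r y u) →
      (K.link {y}).starSum {v ∈ (K.link {y}).vertices | r y v} = 0) := by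
  obtain ⟨h1, h2, h3⟩ := isStrictTotalOn_iff.mp h.order.total
  induction hn : S.ncard generalizing S with
  | zero =>
    rw [Set.ncard_eq_zero (K.vertices_finite.subset hS.subset)] at hn
    exact absurd hn hS.nonempty.ne_empty
  | succ n ihn =>
    have hfin := K.vertices_finite.subset hS.subset
    obtain ⟨y, hy, hmin⟩ := (h.order.total.mono hS.subset).exists_least hfin hS.nonempty
    have hyK := hS.subset hy
    have hins : insert y (S \ {y}) = S := by simp [hy]
    have hrec := K.starSum_insert hyK (S := S \ {y}) (by simp)
    rw [hins] at hrec
    have hmem : ∀ v ∈ K.vertices, v ∈ S \ {y} ↔ r y v := fun v hv =>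
      ⟨fun h => hmin v h.1 h.2, fun h => ⟨hS.upper y hy v hv h, by rintro rfl; exact h1 v hv h⟩⟩
    -- If `S = {y}`, both star sums on the right are those of `∅`, namely 1, and cancel. Then `y` is
    -- the last vertex and the second claim is vacuous.
    rcases (S \ {y}).eq_empty_or_nonempty with he | hne
    · rw [he, starSum_empty, starSum_empty, sub_self] at hrec
      refine ⟨by simp [hrec], fun _ z hz => ?_⟩
      rintro ⟨u, hu, hzu⟩
      rw [he, insert_empty_eq] at hins
      rw [← hins, Set.mem_singleton_iff] at hz
      subst hz
      exact absurd ((hmem u hu).mpr hzu) (by simp [he])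
    · rw [(K.link {y}).starSum_congr (T := {v ∈ (K.link {y}).vertices | r y v})
        fun v hv => by simp only [hmem v (vertices_link_subset K y hv), Set.mem_ofPred_eq, hv,
          true_and]] at hrec
      have hy' : ∃ u ∈ K.vertices, r y u := hne.imp fun u hu =>
        ⟨hS.subset hu.1, hmin u hu.1 hu.2⟩
      have hS' : IsTerminal r K (S \ {y}) :=
        ⟨Set.sdiff_subset.trans hS.subset, hne, fun v hv u hu hvu => (hmem u hu).mpr
          (h2 y hyK v (hS.subset hv.1) u hu (hmin v hv.1 hv.2) hvu)⟩
      obtain ⟨hnn, hz⟩ := ihn hS' (by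
        have := Set.ncard_sdiff_singleton_add_one hy hfin
        omega)
      have hd1 : 1 ≤ d := by
        obtain ⟨s, hs, hmax⟩ := K.faces.exists_le_maximal hyK
        rw [← hd s hmax]
        exact Finset.card_pos.mpr ⟨y, hs (Finset.mem_singleton_self y)⟩
      obtain ⟨e, rfl⟩ : ∃ e, d = e + 1 := ⟨d - 1, by omega⟩
      have hl := ih y hyK hy' e (fun t ht => by
        have := hd _ (maximal_insert_of_maximal_link ht)
        rw [Finset.card_insert_of_notMem (mem_link_singleton.mp ht.prop).1] at this
        omega)
      have hsum : (-1) ^ (e + 1) * K.starSum S = (-1) ^ (e + 1) * K.starSum (S \ {y}) +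
          (-1) ^ e * (K.link {y}).starSum {v ∈ (K.link {y}).vertices | r y v} := by
        rw [hrec]; ring
      refine ⟨hsum ▸ add_nonneg hnn hl, fun h0 z hzS hz' => ?_⟩
      rw [h0, mul_zero] at hsum
      have hpow : ∀ m : ℕ, (-1 : ℤ) ^ m ≠ 0 := fun m => pow_ne_zero m (by norm_num)
      by_cases hzy : z = y
      · subst hzy
        exact (mul_eq_zero.mp (by linarith :
          (-1) ^ e * (K.link {z}).starSum {v ∈ (K.link {z}).vertices | r z v} = 0)).resolve_left
            (hpow e)
      · exact hz ((mul_eq_zero.mp (by linarith :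
          (-1) ^ (e + 1) * K.starSum (S \ {y}) = 0)).resolve_left (hpow _)) z ⟨hzS, hzy⟩ hz'

theorem StarDecomposableInVertices.starSum_nonneg (h : StarDecomposableInVertices K S) {d : ℕ}
    (hd : ∀ s, Maximal (· ∈ K.faces) s → s.card = d) : 0 ≤ (-1) ^ d * K.starSum S := by
  induction h generalizing d with
  | base K hK =>
    rw [← hd ∅ ⟨by simp [hK], fun s hs _ => by simp_all⟩, starSum_empty]
    simp
  | step K S r order link last ihlink ihlast =>
    exact (InducesStarDecompositionInVertices.starSum_of_isTerminal ⟨order, link, last⟩ hd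
      (fun w hw hu e he => ihlink w hw hu he) order.isTerminal).1

theorem InducesStarDecompositionInVertices.starSum_link_eq_zero
    (h : InducesStarDecompositionInVertices r K T) (hS : IsTerminal r K S)
    (h0 : K.starSum S = 0) {y : V} (hy : y ∈ S) (hy' : ∃ u ∈ K.vertices, r y u) :
    (K.link {y}).starSum {v ∈ (K.link {y}).vertices | r y v} = 0 := by
  obtain ⟨s, _, hs⟩ := K.faces.exists_le_maximal (hS.subset hy)
  exact (h.starSum_of_isTerminal (fun t ht => h.order.pure t s ht hs)
    (fun w hw hu e he => (h.link w hw hu).starSum_nonneg he) hS).2 h0 y hy hy'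

theorem starSum_singleton
    {y : V} (hy : y ∈ K.vertices) : K.starSum {y} = 0 := by
  have := K.starSum_insert hy (S := ∅) (by simp)
  rwa [insert_empty_eq, starSum_empty, starSum_empty, sub_self] at this

end Conditions

/-! ### Relabelling of vertices -/

section Map

variable {V W : Type*}

/-- The image of a complex under an injective map of the vertices. -/
def map (f : V ↪ W) (K : FinComplex V) : FinComplex W where
  faces := K.faces.map (Finset.mapEmbedding f).toEmbedding
  down_closed := by
    intro s hs t hts
    simp only [Finset.mem_map, RelEmbedding.coe_toEmbedding, Finset.mapEmbedding_apply] at hs ⊢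
    obtain ⟨a, ha, rfl⟩ := hs
    obtain ⟨b, hb, rfl⟩ := Finset.subset_map_iff.mp hts
    exact ⟨b, K.down_closed a ha b hb, rfl⟩

theorem mem_map {f : V ↪ W} {K : FinComplex V} {s : Finset W} :
    s ∈ (K.map f).faces ↔ ∃ t ∈ K.faces, t.map f = s := by
  simp [map]

theorem map_mem_map {f : V ↪ W} {K : FinComplex V} {s : Finset V} :
    s.map f ∈ (K.map f).faces ↔ s ∈ K.faces := by
  rw [mem_map]
  exact ⟨fun ⟨t, ht, h⟩ => Finset.map_injective f h ▸ ht, fun h => ⟨s, h, rfl⟩⟩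

theorem vertices_map (f : V ↪ W) (K : FinComplex V) : (K.map f).vertices = f '' K.vertices := by
  ext w
  change {w} ∈ (K.map f).faces ↔ _
  rw [mem_map]
  constructor
  · rintro ⟨t, ht, htw⟩
    obtain ⟨v, hv, rfl⟩ : ∃ v ∈ t, f v = w := Finset.mem_map.mp (by rw [htw]; simp)
    exact ⟨v, mem_vertices_of_mem ht hv, rfl⟩
  · rintro ⟨v, hv, rfl⟩
    exact ⟨{v}, hv, Finset.map_singleton f v⟩

theorem map_link [DecidableEq V] [DecidableEq W] (f : V ↪ W) (K : FinComplex V) (v : V) :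
    (K.map f).link {f v} = (K.link {v}).map f := by
  ext s
  constructor
  · intro h
    obtain ⟨hv, hs⟩ := mem_link_singleton.mp h
    obtain ⟨t, rfl⟩ : ∃ t : Finset V, t.map f = s := by
      obtain ⟨t, ht, h⟩ := mem_map.mp hs
      obtain ⟨u, _, hu⟩ := Finset.subset_map_iff.mp ((Finset.subset_insert (f v) s).trans h.ge)
      exact ⟨u, hu.symm⟩
    rw [← Finset.map_insert, map_mem_map] at hs
    exact map_mem_map.mpr (mem_link_singleton.mpr ⟨by simpa using hv, hs⟩)
  · intro h
    obtain ⟨t, ht, rfl⟩ := mem_map.mp h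
    rw [mem_link_singleton] at ht
    rw [mem_link_singleton, ← Finset.map_insert, map_mem_map]
    exact ⟨by simpa using ht.1, ht.2⟩

theorem maximal_of_maximal_map {f : V ↪ W} {K : FinComplex V} {s : Finset V}
    (hs : Maximal (· ∈ (K.map f).faces) (s.map f)) : Maximal (· ∈ K.faces) s :=
  ⟨map_mem_map.mp hs.prop, fun _ ht hst => Finset.map_subset_map.mp
    (hs.le_of_ge (map_mem_map.mpr ht) (Finset.map_subset_map.mpr hst))⟩

theorem IsPure.map {K : FinComplex V} (hK : K.IsPure) (f : V ↪ W) : (K.map f).IsPure := by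
  intro s t hs ht
  obtain ⟨a, _, rfl⟩ := mem_map.mp hs.prop
  obtain ⟨b, _, rfl⟩ := mem_map.mp ht.prop
  rw [Finset.card_map, Finset.card_map]
  exact hK a b (maximal_of_maximal_map hs) (maximal_of_maximal_map ht)

/-- Serves the degenerate joins: joining with `{∅}` only relabels the other factor. -/
theorem StarDecomposableInVertices.map [DecidableEq V] [DecidableEq W] {K : FinComplex V}
    {S : Set V} (h : StarDecomposableInVertices K S) (f : V ↪ W) :
    StarDecomposableInVertices (K.map f) (f '' S) := by
  induction h with
  | base K hK =>
    rw [Set.image_empty]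
    exact .base _ (by simp [FinComplex.map, hK])
  | step K S r order link last ihlink ihlast =>
    obtain ⟨h1, h2, h3⟩ := isStrictTotalOn_iff.mp order.total
    have hS := order.isTerminal
    let q (a b : W) : Prop := ∃ x y, f x = a ∧ f y = b ∧ r x y
    have hq : ∀ x y, q (f x) (f y) ↔ r x y := fun x y =>
      ⟨fun ⟨x', y', hx, hy, h⟩ => f.injective hx ▸ f.injective hy ▸ h, fun h => ⟨x, y, rfl, rfl, h⟩⟩
    have himage : ∀ w, f '' {v ∈ (K.link {w}).vertices | r w v} =
        {v ∈ ((K.map f).link {f w}).vertices | q (f w) v} := by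
      intro w
      rw [map_link, vertices_map]
      ext z
      constructor
      · rintro ⟨v, ⟨hv, hwv⟩, rfl⟩
        exact ⟨⟨v, hv, rfl⟩, (hq w v).mpr hwv⟩
      · rintro ⟨⟨v, hv, rfl⟩, hwv⟩
        exact ⟨v, ⟨hv, (hq w v).mp hwv⟩, rfl⟩
    refine .step _ _ q (IsTerminal.orderCondition ⟨?_, hS.nonempty.image f, ?_⟩
      (order.pure.map f) ?_) ?_ ?_
    · rw [vertices_map]
      exact Set.image_mono hS.subset
    · rw [vertices_map]
      rintro _ ⟨v, hv, rfl⟩ _ ⟨u, hu, rfl⟩ h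
      exact ⟨u, hS.upper v hv u hu ((hq v u).mp h), rfl⟩
    · rw [isStrictTotalOn_iff]
      simp only [vertices_map, Set.forall_mem_image, hq, f.injective.ne_iff]
      exact ⟨h1, h2, h3⟩
    · simp only [vertices_map, Set.forall_mem_image, Set.exists_mem_image, hq]
      intro w hw hu
      have := ihlink w hw hu
      rwa [himage, ← map_link] at this
    · simp only [vertices_map, Set.forall_mem_image, hq]
      intro w hw hu
      have := ihlast w hw hu
      rwa [← vertices_map, ← map_link] at this

end Map

/-! ### Vertices, links and purity of joins -/

section Join

variable {V W : Type*} [DecidableEq V] [DecidableEq W] {X : FinComplex V} {Y : FinComplex W}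

theorem mem_join {s : Finset (V ⊕ W)} :
    s ∈ (X.join Y).faces ↔ s.toLeft ∈ X.faces ∧ s.toRight ∈ Y.faces := by
  simp only [join, Finset.mem_image, Finset.mem_product, Prod.exists]
  constructor
  · rintro ⟨a, b, h, rfl⟩
    simpa using h
  · intro h
    exact ⟨_, _, h, Finset.toLeft_disjSum_toRight⟩

theorem vertices_join (hX : ∅ ∈ X.faces) (hY : ∅ ∈ Y.faces) :
    (X.join Y).vertices = Sum.inl '' X.vertices ∪ Sum.inr '' Y.vertices := by
  ext z
  change {z} ∈ (X.join Y).faces ↔ _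
  rw [mem_join]
  rcases z with x | y
  · have h1 : ({Sum.inl x} : Finset (V ⊕ W)).toLeft = {x} := by ext; simp
    have h2 : ({Sum.inl x} : Finset (V ⊕ W)).toRight = ∅ := by ext; simp
    simp [h1, h2, hY, vertices]
  · have h1 : ({Sum.inr y} : Finset (V ⊕ W)).toRight = {y} := by ext; simp
    have h2 : ({Sum.inr y} : Finset (V ⊕ W)).toLeft = ∅ := by ext; simp
    simp [h1, h2, hX, vertices]

theorem link_join_inl (x : V) : (X.join Y).link {Sum.inl x} = (X.link {x}).join Y := by
  ext s
  rw [mem_link_singleton, mem_join, mem_join, mem_link_singleton, Finset.toLeft_insert_inl,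
    Finset.toRight_insert_inl, Finset.mem_toLeft, and_assoc]

theorem link_join_inr (y : W) : (X.join Y).link {Sum.inr y} = X.join (Y.link {y}) := by
  ext s
  rw [mem_link_singleton, mem_join, mem_join, mem_link_singleton, Finset.toLeft_insert_inr,
    Finset.toRight_insert_inr, Finset.mem_toRight, and_left_comm]

theorem join_eq_map_inr (hX : X.faces = {∅}) : X.join Y = Y.map Function.Embedding.inr := by
  ext s
  rw [mem_join, hX, Finset.mem_singleton, mem_map]
  constructor
  · rintro ⟨h, hs⟩
    refine ⟨_, hs, ?_⟩
    conv_rhs => rw [← Finset.toLeft_disjSum_toRight (u := s), h]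
    simp
  · rintro ⟨t, ht, rfl⟩
    have h1 : (t.map (Function.Embedding.inr : W ↪ V ⊕ W)).toLeft = ∅ := by ext; simp
    have h2 : (t.map (Function.Embedding.inr : W ↪ V ⊕ W)).toRight = t := by ext; simp
    rw [h1, h2]
    exact ⟨rfl, ht⟩

theorem join_eq_map_inl (hY : Y.faces = {∅}) : X.join Y = X.map Function.Embedding.inl := by
  ext s
  rw [mem_join, hY, Finset.mem_singleton, mem_map]
  constructor
  · rintro ⟨hs, h⟩
    refine ⟨_, hs, ?_⟩
    conv_rhs => rw [← Finset.toLeft_disjSum_toRight (u := s), h]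
    simp
  · rintro ⟨t, ht, rfl⟩
    have h1 : (t.map (Function.Embedding.inl : V ↪ V ⊕ W)).toRight = ∅ := by ext; simp
    have h2 : (t.map (Function.Embedding.inl : V ↪ V ⊕ W)).toLeft = t := by ext; simp
    rw [h1, h2]
    exact ⟨ht, rfl⟩

theorem IsPure.join (hX : X.IsPure) (hY : Y.IsPure) : (X.join Y).IsPure := by
  have hl : ∀ s, Maximal (· ∈ (X.join Y).faces) s → Maximal (· ∈ X.faces) s.toLeft := by
    intro s hs
    have hm := mem_join.mp hs.prop
    refine ⟨hm.1, fun t ht hst v hv => ?_⟩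
    have := hs.le_of_ge (y := t.disjSum s.toRight) (mem_join.mpr (by simpa using ⟨ht, hm.2⟩))
      (by
        conv_lhs => rw [← Finset.toLeft_disjSum_toRight (u := s)]
        exact Finset.disjSum_mono hst subset_rfl)
    simpa using this (Finset.inl_mem_disjSum.mpr hv)
  have hr : ∀ s, Maximal (· ∈ (X.join Y).faces) s → Maximal (· ∈ Y.faces) s.toRight := by
    intro s hs
    have hm := mem_join.mp hs.prop
    refine ⟨hm.2, fun t ht hst v hv => ?_⟩
    have := hs.le_of_ge (y := s.toLeft.disjSum t) (mem_join.mpr (by simpa using ⟨hm.1, ht⟩))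
      (by
        conv_lhs => rw [← Finset.toLeft_disjSum_toRight (u := s)]
        exact Finset.disjSum_mono subset_rfl hst)
    simpa using this (Finset.inr_mem_disjSum.mpr hv)
  intro s t hs ht
  rw [← Finset.card_toLeft_add_card_toRight, ← Finset.card_toLeft_add_card_toRight (u := t),
    hX _ _ (hl s hs) (hl t ht), hY _ _ (hr s hs) (hr t ht)]

end Join

/-! ### Star decompositions of joins -/

section JoinDecomposition

variable {V W : Type*} [DecidableEq V] [DecidableEq W]

/-- Joins of star decomposable pairs are star decomposable. -/
def JoinDecomposable (X : FinComplex V) (Y : FinComplex W) : Prop :=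
  ∀ A T, StarDecomposableInVertices X A → StarDecomposableInVertices Y T →
    StarDecomposableInVertices (X.join Y) (Sum.inl '' A ∪ Sum.inr '' T)

/-- Joins with a star decomposable pair whose star has vanishing Euler characteristic are star
decomposable with respect to the vertices of the second factor. -/
def JoinDecomposableRight (X : FinComplex V) (Y : FinComplex W) : Prop :=
  ∀ S, StarDecomposableInVertices X X.vertices → StarDecomposableInVertices Y S →
    Y.starSum S = 0 → StarDecomposableInVertices (X.join Y) (Sum.inr '' S)

theorem setOf_mem_vertices_join {X : FinComplex V} {Y : FinComplex W} (hX : ∅ ∈ X.faces)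
    (hY : ∅ ∈ Y.faces) (p : V ⊕ W → Prop) : {z ∈ (X.join Y).vertices | p z} =
      Sum.inl '' {x ∈ X.vertices | p (.inl x)} ∪ Sum.inr '' {y ∈ Y.vertices | p (.inr y)} := by
  rw [vertices_join hX hY]
  ext (x | y) <;> simp

theorem InducesStarDecompositionInVertices.empty_mem {r : V → V → Prop} {K : FinComplex V}
    {S : Set V} (h : InducesStarDecompositionInVertices r K S) : ∅ ∈ K.faces :=
  h.starDecomposable.empty_mem

/-- For a vertex that is not last, the order decomposing its link with the later vertices also works
with all vertices, which form a terminal set. -/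
theorem InducesStarDecompositionInVertices.starDecomposable_link {r : V → V → Prop}
    {K : FinComplex V} {S : Set V} (h : InducesStarDecompositionInVertices r K S) {w : V}
    (hw : w ∈ K.vertices) : StarDecomposableInVertices (K.link {w}) (K.link {w}).vertices := by
  by_cases hu : ∃ u ∈ K.vertices, r w u
  · rcases (starDecomposableInVertices_iff _ _).mp (h.link w hw hu) with ⟨hK, _⟩ | ⟨q, hq⟩
    · rw [vertices_eq_empty hK]
      exact .base _ hK
    · exact (hq.of_isTerminal hq.isTerminal_vertices).starDecomposable
  · push Not at hu
    exact h.last w hw hu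

/-- The inductive step: an order on the vertices of a join whose last vertex belongs to the second
factor induces a star decomposition if the star of the vertices after the last vertex of the first
factor has vanishing Euler characteristic. -/
theorem inducesStarDecompositionInVertices_join {X : FinComplex V} {Y : FinComplex W}
    {r : V ⊕ W → V ⊕ W → Prop}
    (ih : ∀ (X' : FinComplex V) (Y' : FinComplex W),
      X'.faces.card + Y'.faces.card < X.faces.card + Y.faces.card →
        JoinDecomposable X' Y' ∧ JoinDecomposableRight X' Y')
    (hr : IsStrictTotalOn r (Sum.inl '' X.vertices ∪ Sum.inr '' Y.vertices))
    {A : Set V} (hX : InducesStarDecompositionInVertices (fun a b => r (.inl a) (.inl b)) X A)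
    {T : Set W} (hY : InducesStarDecompositionInVertices (fun a b => r (.inr a) (.inr b)) Y T)
    {xlast : V} (hxlast : xlast ∈ X.vertices)
    (hxmax : ∀ x ∈ X.vertices, x ≠ xlast → r (.inl x) (.inl xlast))
    (hne : ∃ y ∈ Y.vertices, r (.inl xlast) (.inr y))
    (hS : Y.starSum {y ∈ Y.vertices | r (.inl xlast) (.inr y)} = 0)
    {U : Set (V ⊕ W)} (hU : IsTerminal r (X.join Y) U) :
    InducesStarDecompositionInVertices r (X.join Y) U := by
  have hX0 := hX.empty_mem
  have hY0 := hY.empty_mem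
  have hv := vertices_join hX0 hY0
  obtain ⟨h1, h2, h3⟩ := isStrictTotalOn_iff.mp hr
  have hlv : ∀ x ∈ X.vertices, (Sum.inl x : V ⊕ W) ∈
      Sum.inl '' X.vertices ∪ Sum.inr '' Y.vertices := fun x hx => Or.inl ⟨x, hx, rfl⟩
  have hrv : ∀ y ∈ Y.vertices, (Sum.inr y : V ⊕ W) ∈
      Sum.inl '' X.vertices ∪ Sum.inr '' Y.vertices := fun y hy => Or.inr ⟨y, hy, rfl⟩
  have hS' : IsTerminal (fun a b => r (.inr a) (.inr b)) Y
      {y ∈ Y.vertices | r (.inl xlast) (.inr y)} :=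
    ⟨fun y hy => hy.1, hne, fun v hv u hu hvu => ⟨hu, h2 _ (hlv _ hxlast) _ (hrv v hv.1) _
      (hrv u hu) hv.2 hvu⟩⟩
  have hx_lt : ∀ x ∈ X.vertices, ∃ y ∈ Y.vertices, r (.inl x) (.inr y) := by
    obtain ⟨y, hy, hxy⟩ := hne
    intro x hx
    refine ⟨y, hy, ?_⟩
    by_cases hxl : x = xlast
    · rwa [hxl]
    · exact h2 _ (hlv x hx) _ (hlv _ hxlast) _ (hrv y hy) (hxmax x hx hxl) hxy
  have hlast : ∀ x ∈ X.vertices, ¬ r (.inl xlast) (.inl x) := by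
    intro x hx h
    by_cases hxl : x = xlast
    · exact h1 _ (hlv x hx) (hxl ▸ h)
    · exact h1 _ (hlv x hx) (h2 _ (hlv x hx) _ (hlv _ hxlast) _ (hlv x hx) (hxmax x hx hxl) h)
  refine ⟨hU.orderCondition (hX.order.pure.join hY.order.pure) (hv ▸ hr), ?_, ?_⟩
  · rw [hv]
    rintro _ (⟨x, hx, rfl⟩ | ⟨y, hy, rfl⟩) hlt
    · have hXx := hX.starDecomposable_link hx
      rw [link_join_inl, setOf_mem_vertices_join hXx.empty_mem hY0]
      have hih := ih (X.link {x}) Y (by have := card_link_lt hx; omega)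
      -- After `xlast` only vertices of `Y` remain, and `hS` supplies the vanishing; before it,
      -- later vertices exist in both factors of the order.
      by_cases hxl : x = xlast
      · subst hxl
        have hempty : {v ∈ (X.link {x}).vertices | r (.inl x) (.inl v)} = ∅ :=
          Set.eq_empty_of_forall_notMem fun v hv => hlast v (vertices_link_subset _ _ hv.1) hv.2
        rw [hempty, Set.image_empty, Set.empty_union]
        exact hih.2 _ hXx (hY.of_isTerminal hS').starDecomposable hS
      · have hT' : IsTerminal (fun a b => r (.inr a) (.inr b)) Y
            {y ∈ Y.vertices | r (.inl x) (.inr y)} :=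
          ⟨fun y hy => hy.1, hx_lt x hx, fun v hv u hu hvu => ⟨hu, h2 _ (hlv x hx) _
            (hrv v hv.1) _ (hrv u hu) hv.2 hvu⟩⟩
        exact hih.1 _ _ (hX.link x hx ⟨xlast, hxlast, hxmax x hx hxl⟩)
          (hY.of_isTerminal hT').starDecomposable
    · have hYy := hY.starDecomposable_link hy
      rw [link_join_inr, setOf_mem_vertices_join hX0 hYy.empty_mem]
      have hih := ih X (Y.link {y}) (by have := card_link_lt hy; omega)
      have hyy : ∃ u ∈ Y.vertices, r (.inr y) (.inr u) := by
        obtain ⟨_, ⟨x, hx, rfl⟩ | ⟨u, hu, rfl⟩, hyz⟩ := hlt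
        · obtain ⟨u, hu, hxu⟩ := hx_lt x hx
          exact ⟨u, hu, h2 _ (hrv y hy) _ (hlv x hx) _ (hrv u hu) hyz hxu⟩
        · exact ⟨u, hu, hyz⟩
      -- If `y` precedes `xlast`, some vertices of `X` are still to come. Otherwise none are, and
      -- the vanishing for the link of `y` is inherited from `hS`.
      by_cases hyx : r (.inr y) (.inl xlast)
      · have hA' : IsTerminal (fun a b => r (.inl a) (.inl b)) X
            {x ∈ X.vertices | r (.inr y) (.inl x)} :=
          ⟨fun x hx => hx.1, ⟨xlast, hxlast, hyx⟩, fun v hv u hu hvu => ⟨hu, h2 _ (hrv y hy) _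
            (hlv v hv.1) _ (hlv u hu) hv.2 hvu⟩⟩
        exact hih.1 _ _ (hX.of_isTerminal hA').starDecomposable (hY.link y hy hyy)
      · have hempty : {v ∈ X.vertices | r (.inr y) (.inl v)} = ∅ := by
          refine Set.eq_empty_of_forall_notMem fun v hv => hyx ?_
          by_cases hvl : v = xlast
          · exact hvl ▸ hv.2
          · exact h2 _ (hrv y hy) _ (hlv v hv.1) _ (hlv _ hxlast) hv.2 (hxmax v hv.1 hvl)
        rw [hempty, Set.image_empty, Set.empty_union]
        have hyS : r (.inl xlast) (.inr y) :=
          (h3 _ (hrv y hy) _ (hlv _ hxlast) (by simp)).resolve_left hyx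
        exact hih.2 _ (hX.of_isTerminal hX.isTerminal_vertices).starDecomposable
          (hY.link y hy hyy) (hY.starSum_link_eq_zero hS' hS ⟨hy, hyS⟩ hyy)
  · rw [hv]
    rintro _ (⟨x, hx, rfl⟩ | ⟨y, hy, rfl⟩) hmax
    · obtain ⟨y, hy, hxy⟩ := hx_lt x hx
      exact absurd hxy (hmax _ (hrv y hy))
    · have hYy := hY.starDecomposable_link hy
      rw [link_join_inr, vertices_join hX0 hYy.empty_mem]
      exact (ih X (Y.link {y}) (by have := card_link_lt hy; omega)).1 _ _
        (hX.of_isTerminal hX.isTerminal_vertices).starDecomposable hYy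

/-- Orders on the vertices of the factors of a join combine to one of the join in which the
terminal set `B` comes last, preceded by the terminal set `A` and, before it, the rest of the
terminal set `T`. -/
theorem exists_join_order {X : FinComplex V} {Y : FinComplex W} {q : V → V → Prop}
    {p : W → W → Prop} {A : Set V} {B T : Set W}
    (hX : InducesStarDecompositionInVertices q X A) (hY : InducesStarDecompositionInVertices p Y T)
    (hB : IsTerminal p Y B) (hBT : B ⊆ T) :
    ∃ r : V ⊕ W → V ⊕ W → Prop,
      IsStrictTotalOn r (Sum.inl '' X.vertices ∪ Sum.inr '' Y.vertices) ∧
      InducesStarDecompositionInVertices (fun a b => r (.inl a) (.inl b)) X A ∧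
      InducesStarDecompositionInVertices (fun a b => r (.inr a) (.inr b)) Y T ∧
      (∀ x ∈ A, ∀ y, r (.inl x) (.inr y) ↔ y ∈ B) ∧
      (∀ x ∈ A, ∀ y ∈ B, ¬ r (.inr y) (.inl x)) ∧
      IsTerminal r (X.join Y) (Sum.inl '' A ∪ Sum.inr '' T) := by
  classical
  obtain ⟨q1, q2, q3⟩ := isStrictTotalOn_iff.mp hX.order.total
  obtain ⟨p1, p2, p3⟩ := isStrictTotalOn_iff.mp hY.order.total
  have hA := hX.order.isTerminal
  have hT := hY.order.isTerminal
  -- The blocks appear in the order `X \ A`, `Y \ B`, `A`, `B`, each with its given order.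
  let r : V ⊕ W → V ⊕ W → Prop
    | .inl a, .inl b => q a b
    | .inr a, .inr b => p a b
    | .inl a, .inr b => if a ∈ A then b ∈ B else True
    | .inr a, .inl b => if b ∈ A then a ∉ B else False
  refine ⟨r, ?_, hX, hY, fun x hx y => by simp [r, hx],
    fun x hx y hy => by simp [r, hx, hy], ?_⟩
  · have hAu := hA.upper
    have hBu := hB.upper
    rw [isStrictTotalOn_iff]
    refine ⟨?_, ?_, ?_⟩
    · rintro _ (⟨x, hx, rfl⟩ | ⟨y, hy, rfl⟩)
      exacts [q1 x hx, p1 y hy]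
    · rintro _ (⟨a, ha, rfl⟩ | ⟨a, ha, rfl⟩) _ (⟨b, hb, rfl⟩ | ⟨b, hb, rfl⟩) _
        (⟨c, hc, rfl⟩ | ⟨c, hc, rfl⟩) <;> simp only [r] <;> grind
    · rintro _ (⟨a, ha, rfl⟩ | ⟨a, ha, rfl⟩) _ (⟨b, hb, rfl⟩ | ⟨b, hb, rfl⟩) hab
      · exact q3 a ha b hb (by simpa using hab)
      · simp only [r]; grind
      · simp only [r]; grind
      · exact p3 a ha b hb (by simpa using hab)
  · have hv := vertices_join hX.empty_mem hY.empty_mem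
    refine ⟨?_, (hA.nonempty.image _).inl, ?_⟩
    · rw [hv]
      exact Set.union_subset_union (Set.image_mono hA.subset) (Set.image_mono hT.subset)
    · rw [hv]
      rintro _ (⟨x, hx, rfl⟩ | ⟨y, hy, rfl⟩) _ (⟨u, hu, rfl⟩ | ⟨u, hu, rfl⟩) h
      · exact Or.inl ⟨u, hA.upper x hx u hu h, rfl⟩
      · simp only [r, hx, if_true] at h
        exact Or.inr ⟨u, hBT h, rfl⟩
      · simp only [r] at h
        split_ifs at h with hu'
        exact Or.inl ⟨u, hu', rfl⟩
      · exact Or.inr ⟨u, hT.upper y hy u hu h, rfl⟩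

/-- The two statements need a simultaneous induction, since the links in either one can be of both
kinds. Each follows from the inductive step once an order is chosen in which a terminal set `B` of
`Y` with star sum zero comes after all of `X`. -/
theorem joinDecomposable (X : FinComplex V) (Y : FinComplex W) :
    JoinDecomposable X Y ∧ JoinDecomposableRight X Y := by
  induction hn : X.faces.card + Y.faces.card using Nat.strong_induction_on generalizing X Y with
  | _ n ihn =>
  subst hn
  have ih : ∀ (X' : FinComplex V) (Y' : FinComplex W),
      X'.faces.card + Y'.faces.card < X.faces.card + Y.faces.card →
        JoinDecomposable X' Y' ∧ JoinDecomposableRight X' Y' :=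
    fun X' Y' h => ihn _ h X' Y' rfl
  have aux : ∀ {q p A B T}, InducesStarDecompositionInVertices q X A →
      InducesStarDecompositionInVertices p Y T → IsTerminal p Y B → B ⊆ T → Y.starSum B = 0 →
      ∃ r : V ⊕ W → V ⊕ W → Prop, IsTerminal r (X.join Y) (Sum.inl '' A ∪ Sum.inr '' T) ∧
        (∀ x ∈ A, ∀ y ∈ B, ¬ r (.inr y) (.inl x)) ∧
        ∀ U, IsTerminal r (X.join Y) U → StarDecomposableInVertices (X.join Y) U := by
    intro q p A B T hX hY hB hBT h0
    obtain ⟨r, hr, hrX, hrY, hAB, hBA, hU⟩ := exists_join_order hX hY hB hBT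
    obtain ⟨x, hx, hxmax⟩ :=
      hrX.order.total.exists_greatest X.vertices_finite hX.order.vertices_nonempty
    -- Since the last vertex of `X` lies in `A`, the vertices of `Y` after it are exactly those of
    -- `B`.
    have hxA : x ∈ A := by
      obtain ⟨a, ha⟩ := hX.order.isTerminal.nonempty
      by_cases hax : a = x
      · rwa [← hax]
      · have haX := hX.order.isTerminal.subset ha
        exact hrX.order.isTerminal.upper a ha x hx (hxmax a haX hax)
    refine ⟨r, hU, hBA, fun U hU => (inducesStarDecompositionInVertices_join ih hr hrX hrY hx hxmax
      ?_ ?_ hU).starDecomposable⟩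
    · obtain ⟨b, hb⟩ := hB.nonempty
      exact ⟨b, hB.subset hb, (hAB x hxA b).mpr hb⟩
    · rw [← h0]
      exact Y.starSum_congr fun y hy => ⟨fun h => (hAB x hxA y).mp h.2,
        fun h => ⟨hy, (hAB x hxA y).mpr h⟩⟩
  constructor
  · intro A T hA hT
    rcases (starDecomposableInVertices_iff _ _).mp hA with ⟨hX, rfl⟩ | ⟨q, hq⟩
    · rw [join_eq_map_inr hX, Set.image_empty, Set.empty_union]
      exact hT.map _
    rcases (starDecomposableInVertices_iff _ _).mp hT with ⟨hY, rfl⟩ | ⟨p, hp⟩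
    · rw [join_eq_map_inl hY, Set.image_empty, Set.union_empty]
      exact hA.map _
    obtain ⟨y, hy, hymax⟩ :=
      hp.order.total.exists_greatest Y.vertices_finite hp.order.vertices_nonempty
    obtain ⟨p1, p2, -⟩ := isStrictTotalOn_iff.mp hp.order.total
    have hyT : y ∈ T := by
      obtain ⟨b, hb⟩ := hp.order.isTerminal.nonempty
      by_cases hby : b = y
      · rwa [← hby]
      · exact hp.order.isTerminal.upper b hb y hy (hymax b (hp.order.isTerminal.subset hb) hby)
    -- With `B` the last vertex alone, the star is a cone, so its star sum vanishes without any
    -- assumption on `T`.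
    have hB : IsTerminal p Y {y} := by
      refine ⟨Set.singleton_subset_iff.mpr hy, Set.singleton_nonempty y, ?_⟩
      rintro v rfl u hu hvu
      by_contra huv
      exact p1 u hu (p2 u hu v hy u hu (hymax u hu huv) hvu)
    obtain ⟨r, hU, -, hr⟩ := aux hq hp hB (Set.singleton_subset_iff.mpr hyT) (starSum_singleton hy)
    exact hr _ hU
  · intro S hXX hS h0
    rcases (starDecomposableInVertices_iff _ _).mp hS with ⟨hY, rfl⟩ | ⟨p, hp⟩
    -- Dimension `-1` is excluded: the star sum of the empty set is 1.
    · rw [starSum_empty] at h0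
      exact absurd h0 one_ne_zero
    rcases (starDecomposableInVertices_iff _ _).mp hXX with ⟨hX, -⟩ | ⟨q, hq⟩
    · rw [join_eq_map_inr hX]
      exact hS.map _
    have hSt := hp.order.isTerminal
    -- Here `B = S`, so nothing of `X` follows an element of `S`, which makes `S` alone terminal in
    -- the join.
    obtain ⟨r, hU, hBA, hr⟩ := aux hq hp hSt subset_rfl h0
    refine hr _ ⟨Set.subset_union_right.trans hU.subset, hSt.nonempty.image _, ?_⟩
    rintro _ ⟨y, hy, rfl⟩ u hu hyu
    rcases hU.upper _ (Or.inr ⟨y, hy, rfl⟩) u hu hyu with ⟨x, hx, rfl⟩ | h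
    · exact absurd hyu (hBA x hx y hy)
    · exact h

end JoinDecomposition

end FinComplex

theorem propositionp {V W : Type*} [DecidableEq V] [DecidableEq W]
    (X : FinComplex V) (Y : FinComplex W)
    (hXpure : X.IsPure) (hYpure : Y.IsPure) (hXdim : 0 ≤ X.dim) (hYdim : 0 ≤ Y.dim)
    (S : Set W) (hSsub : S ⊆ Y.vertices) (hSne : S.Nonempty)
    (hX : X.StarDecomposableInVertices X.vertices)
    (hY : Y.StarDecomposableInVertices S)
    (hS : (Y.sd.starSet ((fun y => {y}) '' S)).HasTrivialReducedHomology)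
    (r : V ⊕ W → V ⊕ W → Prop)
    (hr : FinComplex.IsStrictTotalOn r (Sum.inl '' X.vertices ∪ Sum.inr '' Y.vertices))
    (hrX : FinComplex.InducesStarDecompositionInVertices
      (fun a b => r (Sum.inl a) (Sum.inl b)) X X.vertices)
    (hrY : FinComplex.InducesStarDecompositionInVertices
      (fun a b => r (Sum.inr a) (Sum.inr b)) Y S)
    (xlast : V) (hxlast : xlast ∈ X.vertices)
    (hxmax : ∀ x ∈ X.vertices, x ≠ xlast → r (Sum.inl x) (Sum.inl xlast))
    (hrS : Sum.inr '' S =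
      {z ∈ Sum.inl '' X.vertices ∪ Sum.inr '' Y.vertices | r (Sum.inl xlast) z}) :
    FinComplex.InducesStarDecompositionInVertices r (X.join Y) (Sum.inr '' S) := by
  have hv := FinComplex.vertices_join hrX.empty_mem hrY.empty_mem
  have hSiff : ∀ y ∈ Y.vertices, r (.inl xlast) (.inr y) ↔ y ∈ S := by
    intro y hy
    have h : (Sum.inr y : V ⊕ W) ∈ Sum.inr '' S ↔ _ := Set.ext_iff.mp hrS (.inr y)
    rw [Sum.inr_injective.mem_set_image] at h
    exact ⟨fun h' => h.mpr ⟨Or.inr ⟨y, hy, rfl⟩, h'⟩, fun h' => (h.mp h').2⟩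
  refine FinComplex.inducesStarDecompositionInVertices_join
    (fun X' Y' _ => FinComplex.joinDecomposable X' Y') hr hrX hrY hxlast hxmax ?_ ?_
    ⟨?_, hSne.image _, ?_⟩
  · obtain ⟨y, hy⟩ := hSne
    exact ⟨y, hSsub hy, (hSiff y (hSsub hy)).mpr hy⟩
  -- The vertices of `Y` after `xlast` are those of `S`; acyclicity gives the vanishing.
  · rw [← FinComplex.starSum_eq_zero_of_hasTrivialReducedHomology hSsub hSne hS]
    exact Y.starSum_congr fun y hy => by simp [hy, hSiff y hy]
  · rw [hv]
    exact (Set.image_mono hSsub).trans Set.subset_union_right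
  · rw [hv, hrS]
    rintro v ⟨hv, hxv⟩ u hu hvu
    exact ⟨hu, (FinComplex.isStrictTotalOn_iff.mp hr).2.1 _ (Or.inl ⟨xlast, hxlast, rfl⟩) v hv u hu
      hxv hvu⟩
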